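/- Let $n\ge 0$, let $T$ be a finite (geometric) simplicial complex in some $\mathbb{R}^N$, and suppose that its underlying space $X=\bigcup_{\sigma\in T}\sigma$ is homeomorphic to the closed unit ball $B^n=\{x\in\mathbb{R}^n:\|x\|_2\le 1\}$. Let $\partial X$ be the boundary of $X$, that is, the image of the unit sphere $S^{n-1}$ under a homeomorphism $B^n\to X$, and suppose that $T$ is antipodally symmetric on the boundary: for every simplex $\sigma\in T$ with $\sigma\subseteq\partial X$, the reflected simplex $-\sigma$ also belongs to $T$ and is contained in $\partial X$. Let $\square^n=\mathrm{conv}(\{-1,1\}^n)$ and let $\lambda$ be a function from the vertices of $T$ to the set $\mathrm{ext}(\square^n)=\{-1,1\}^n$ of extreme points of the cube such that $\lambda(v)=-\lambda(-v)$ for every vertex $v$ of $T$ with $v\in\partial X$. Then $T$ contains a neutral simplex, that is, a simplex $\sigma\in T$ such that for every $1\le i\le n$ there are vertices $v_1,v_2$ of $\sigma$ with $\lambda(v_1)_i=-1$ and $\lambda(v_2)_i=+1$. -/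

import Mathlib

/-- The `n`-dimensional cube: the convex hull of the vectors all of whose coordinates are `1`
or `-1`. -/
def cube (n : ℕ) : Set (Fin n → ℝ) :=
  convexHull ℝ {x | ∀ i, x i = 1 ∨ x i = -1}

/-- The extreme points of the cube are exactly the sign vectors. -/
theorem mem_extremePoints_cube_iff (n : ℕ) (x : Fin n → ℝ) :
    x ∈ (cube n).extremePoints ℝ ↔ ∀ i, x i = 1 ∨ x i = -1 := by
  constructor
  · intro h
    exact extremePoints_convexHull_subset h
  · intro h
    have hsub : cube n ⊆ Set.univ.pi fun _ : Fin n => Set.Icc (-1 : ℝ) 1 := by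
      refine convexHull_min ?_ (convex_pi fun _ _ => convex_Icc _ _)
      intro y hy i _
      rcases hy i with h1 | h1 <;> rw [h1] <;> norm_num
    refine ⟨subset_convexHull ℝ _ h, ?_⟩
    intro y hy z hz ⟨a, b, ha, hb, hab, hx⟩
    ext i
    have hyi := hsub hy i (Set.mem_univ i)
    have hzi := hsub hz i (Set.mem_univ i)
    have hxi : a * y i + b * z i = x i := by simpa using congrFun hx i
    rw [Set.mem_Icc] at hyi hzi
    rcases h i with h1 | h1 <;> rw [h1] at hxi ⊢ <;> nlinarith

/-- For a set `X` with a homeomorphism `e` from the closed unit ball of `ℝⁿ` onto it, the boundary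
`∂X` of `X`: the image of the unit sphere. (By invariance of domain it does not depend on `e`, and
it is the topological frontier of `X` when `X` lies in `ℝⁿ`.) -/
def ballBoundary {n : ℕ} {E : Type*} [TopologicalSpace E] {X : Set E}
    (e : Metric.closedBall (0 : EuclideanSpace ℝ (Fin n)) 1 ≃ₜ X) : Set E :=
  {x | ∃ u : Metric.closedBall (0 : EuclideanSpace ℝ (Fin n)) 1,
    ‖(u : EuclideanSpace ℝ (Fin n))‖ = 1 ∧ (e u : E) = x}

/-- The simplices of `T` (given by their vertex sets) which lie entirely in the set `B`. For
`B = ∂X` this is the boundary `∂T` of a triangulation `T` of `X`. -/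
def facesIn {E : Type*} [AddCommGroup E] [Module ℝ E]
    (T : Geometry.SimplicialComplex ℝ E) (B : Set E) : Set (Finset E) :=
  {s | s ∈ T.faces ∧ convexHull ℝ (s : Set E) ⊆ B}

/-- For every simplex `σ` of `T` lying in `B`, the reflected simplex `-σ` is also a simplex of `T`
lying in `B`. For `B = ∂X` this says that `T` is antipodally symmetric on the boundary. -/
def AntipodallySymmetricOn {E : Type*} [AddCommGroup E] [Module ℝ E]
    (T : Geometry.SimplicialComplex ℝ E) (B : Set E) : Prop :=
  ∀ s ∈ facesIn T B, s.map (Equiv.neg E).toEmbedding ∈ facesIn T B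

/-- The simplex with vertex set `s` is neutral for the labelling `lab`: in every coordinate both
signs occur among the labels of its vertices. -/
def IsNeutral {E : Type*} {n : ℕ} (lab : E → Fin n → ℝ) (s : Finset E) : Prop :=
  ∀ i : Fin n, ∃ v₁ ∈ s, ∃ v₂ ∈ s, lab v₁ i = -1 ∧ lab v₂ i = 1

/-! Extend the labelling affinely over each simplex to a continuous map L from X to ℝⁿ. A zero of L
lies in a simplex on which 0 is a convex combination of vectors with entries ±1; no coordinate is
constant on its vertices, so the simplex is neutral. On ∂X the map L is odd under x ↦ -x, and a
Borsuk–Ulam argument yields the zero.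

Carried to the unit sphere by the homeomorphism, x ↦ -x becomes some continuous involution τ, not
the antipodal one. `exists_equivariant_crossSphere` builds an equivariant map from the antipodal
(n-1)-sphere to it, one dimension at a time. Extending this map over the ball, composing with L and
reflecting gives an odd map from the n-sphere to ℝⁿ (`exists_zero_of_involution`).

The symmetry hypothesis concerns simplices inside ∂X, so each boundary point must be placed in one.
Homeomorphisms of the ball preserve its sphere (`norm_eq_one_of_homeomorph`, again by Borsuk–Ulam),
and any two points of an open simplex are exchanged by a homeomorphism of X; hence ∂X is a union of
closed simplices.

`borsukUlam` itself is combinatorial: a mod 2 cup product of sign changes takes the value 1 on every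
hemisphere of the subdivided cross-polytope, so some tiny simplex sees a sign change in every
coordinate. -/

/-- Chains modulo two of ordered simplices, the empty simplex included. -/
abbrev Chain (E : Type*) := List E →₀ ZMod 2

/-! ### Mod 2 chains, boundary operator and sign changes -/

namespace Chain

variable {E F : Type*}

theorem add_self_eq_zero (c : Chain E) : c + c = 0 := by
  ext l
  exact CharTwo.add_self_eq_zero _

/-- The cone over a chain with apex `a`. -/
noncomputable def cone (a : E) : Chain E →ₗ[ZMod 2] Chain E :=
  Finsupp.lmapDomain _ _ (List.cons a)

/-- The linear map on chains with given values on simplices. -/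
noncomputable def lift {M : Type*} [AddCommGroup M] [Module (ZMod 2) M] (f : List E → M) :
    Chain E →ₗ[ZMod 2] M :=
  Finsupp.linearCombination (ZMod 2) f

@[simp]
theorem lift_single {M : Type*} [AddCommGroup M] [Module (ZMod 2) M] (f : List E → M)
    (l : List E) : lift f (Finsupp.single l 1) = f l := by
  simp [lift]

@[simp]
theorem cone_single (a : E) (l : List E) :
    cone a (Finsupp.single l 1) = Finsupp.single (a :: l) 1 := by
  simp [cone]

theorem hom_ext {M : Type*} [AddCommGroup M] [Module (ZMod 2) M] {f g : Chain E →ₗ[ZMod 2] M}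
    (h : ∀ l, f (Finsupp.single l 1) = g (Finsupp.single l 1)) : f = g :=
  Finsupp.lhom_ext' fun l => LinearMap.ext_ring (h l)

/-- The boundary of a simplex. -/
noncomputable def bdList : List E → Chain E
  | [] => 0
  | a :: l => Finsupp.single l 1 + cone a (bdList l)

/-- The boundary operator. -/
noncomputable def bd : Chain E →ₗ[ZMod 2] Chain E := lift bdList

@[simp]
theorem bd_single_nil : bd (Finsupp.single ([] : List E) 1) = 0 := by
  simp [bd, bdList]

theorem bd_single_cons (a : E) (l : List E) : bd (Finsupp.single (a :: l) 1) =
    Finsupp.single l 1 + cone a (bd (Finsupp.single l 1)) := by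
  simp [bd, bdList]

theorem bd_cone (a : E) (c : Chain E) : bd (cone a c) = c + cone a (bd c) := by
  have : bd.comp (cone a) = LinearMap.id + (cone a).comp bd :=
    hom_ext fun l => by simp [bd_single_cons]
  exact LinearMap.congr_fun this c

theorem bd_bd (c : Chain E) : bd (bd c) = 0 := by
  have : (bd.comp bd : Chain E →ₗ[ZMod 2] Chain E) = 0 := by
    refine hom_ext fun l => ?_
    induction l with
    | nil => simp
    | cons a l ih =>
      simp only [LinearMap.comp_apply, LinearMap.zero_apply] at ih ⊢
      rw [bd_single_cons, map_add, bd_cone, ih, map_zero, add_zero, add_self_eq_zero]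
  exact LinearMap.congr_fun this c

/-- The chain map induced by a map of points. -/
noncomputable def map (f : E → F) : Chain E →ₗ[ZMod 2] Chain F :=
  Finsupp.lmapDomain _ _ (List.map f)

@[simp]
theorem map_single (f : E → F) (l : List E) :
    map f (Finsupp.single l 1) = Finsupp.single (l.map f) 1 := by
  simp [map]

theorem map_cone (f : E → F) (a : E) (c : Chain E) : map f (cone a c) = cone (f a) (map f c) := by
  have : (map f).comp (cone a) = (cone (f a)).comp (map f) := hom_ext fun l => by simp
  exact LinearMap.congr_fun this c

theorem map_bd (f : E → F) (c : Chain E) : map f (bd c) = bd (map f c) := by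
  have : (map f).comp bd = bd.comp (map f) := by
    refine hom_ext fun l => ?_
    induction l with
    | nil => simp
    | cons a l ih =>
      simp only [LinearMap.comp_apply, map_single, List.map_cons] at ih ⊢
      rw [bd_single_cons, bd_single_cons, map_add, map_cone, ih, map_single]
  exact LinearMap.congr_fun this c

/-- The chains all of whose simplices satisfy `P`. -/
abbrev on (P : List E → Prop) : Submodule (ZMod 2) (Chain E) :=
  Finsupp.supported (ZMod 2) (ZMod 2) {l | P l}

theorem single_mem_on {P : List E → Prop} {l : List E} (h : P l) :
    (Finsupp.single l 1 : Chain E) ∈ on P :=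
  Finsupp.single_mem_supported _ _ h

theorem on_mono {P Q : List E → Prop} (h : ∀ l, P l → Q l) {c : Chain E} (hc : c ∈ on P) :
    c ∈ on Q :=
  Finsupp.supported_mono h hc

theorem on_induction {P : List E → Prop} {M : Type*} [AddCommGroup M] [Module (ZMod 2) M]
    {f : Chain E →ₗ[ZMod 2] M} {N : Submodule (ZMod 2) M}
    (h : ∀ l, P l → f (Finsupp.single l 1) ∈ N) {c : Chain E} (hc : c ∈ on P) : f c ∈ N := by
  have : on P ≤ N.comap f := by
    rw [on, Finsupp.supported_eq_span_single, Submodule.span_le]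
    rintro _ ⟨l, hl, rfl⟩
    exact h l hl
  exact this hc

theorem cone_mem_on {P Q : List E → Prop} {a : E} (h : ∀ l, P l → Q (a :: l)) {c : Chain E}
    (hc : c ∈ on P) : cone a c ∈ on Q :=
  on_induction (f := cone a) (fun l hl => by
    rw [cone_single]; exact single_mem_on (h l hl)) hc

theorem bd_single_mem_on (l : List E) :
    bd (Finsupp.single l 1) ∈ on fun t : List E => t.length + 1 = l.length ∧ t ⊆ l := by
  induction l with
  | nil => simp
  | cons a l ih =>
    rw [bd_single_cons]
    refine add_mem (single_mem_on ⟨rfl, List.subset_cons_self _ _⟩) (cone_mem_on ?_ ih)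
    rintro t ⟨h1, h2⟩
    exact ⟨by simp [h1], List.cons_subset_cons _ h2⟩

/-! ### Cup products of sign functions -/

variable (s : ℕ → E → ZMod 2)

/-- The cochain which is the product of the changes of `s (k - 1), …, s 0` along the edges of a
`k`-dimensional simplex. -/
def cupList : ℕ → List E → ZMod 2
  | 0, _ => 1
  | _ + 1, [] => 0
  | k + 1, [a] => s k a * cupList k []
  | k + 1, a :: b :: l => s k a * cupList k (b :: l) + s k b * cupList k (b :: l)

/-- The product of `cupList s k` with the value of `s k` at the first vertex. -/
def headList (k : ℕ) : List E → ZMod 2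
  | [] => 0
  | a :: l => s k a * cupList s k (a :: l)

/-- The linear extension of `cupList`. -/
noncomputable def cup (k : ℕ) : Chain E →ₗ[ZMod 2] ZMod 2 := lift (cupList s k)

/-- The linear extension of `headList`. -/
noncomputable def head (k : ℕ) : Chain E →ₗ[ZMod 2] ZMod 2 := lift (headList s k)

/-- The values of `cupList` on lists that are too short are chosen so that this recursion holds
without a length hypothesis. -/
theorem cupList_succ_cons (k : ℕ) (a : E) (l : List E) :
    cupList s (k + 1) (a :: l) = s k a * cupList s k l + headList s k l := by
  cases l <;> simp [cupList, headList]

theorem cup_succ_cone (k : ℕ) (a : E) (c : Chain E) :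
    cup s (k + 1) (cone a c) = s k a * cup s k c + head s k c := by
  have : (cup s (k + 1)).comp (cone a) = s k a • cup s k + head s k :=
    hom_ext fun l => by simp [cup, head, cupList_succ_cons]
  exact LinearMap.congr_fun this c

theorem head_cone (k : ℕ) (a : E) (c : Chain E) :
    head s k (cone a c) = s k a * cup s k (cone a c) := by
  have : (head s k).comp (cone a) = s k a • (cup s k).comp (cone a) :=
    hom_ext fun l => by simp [cup, head, headList]
  exact LinearMap.congr_fun this c

/-- The Leibniz rule: `head` is the product of the 0-cochain `s k` with the cocycle `cup s k`, so
its coboundary is the change of `s k` times `cup s k`. The two claims are proved together because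
closedness in degree k + 1 uses both in degree k. -/
theorem cup_bd_single_and_head_bd_single (k : ℕ) (l : List E) (hl : l.length = k + 2) :
    cup s k (bd (Finsupp.single l 1)) = 0 ∧
      head s k (bd (Finsupp.single l 1)) = cup s (k + 1) (Finsupp.single l 1) := by
  induction k generalizing l with
  | zero =>
    obtain ⟨a, b, rfl⟩ := List.length_eq_two.1 hl
    simp [bd_single_cons, cup, head, headList, cupList, CharTwo.add_self_eq_zero, add_comm]
  | succ k ih =>
    cases l with
    | nil => simp at hl
    | cons a t =>
      obtain ⟨h1, h2⟩ := ih t (by simpa using hl)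
      have h3 : cup s (k + 1) (cone a (bd (Finsupp.single t 1))) =
          cup s (k + 1) (Finsupp.single t 1) := by
        rw [cup_succ_cone, h1, h2, mul_zero, zero_add]
      rw [bd_single_cons, map_add, map_add, head_cone, h3]
      refine ⟨CharTwo.add_self_eq_zero _, ?_⟩
      rw [← cone_single, cup_succ_cone, add_comm]

theorem head_bd {k : ℕ} {c : Chain E} (hc : c ∈ on fun l : List E => l.length = k + 2) :
    head s k (bd c) = cup s (k + 1) c := by
  have := on_induction (f := (head s k).comp bd + cup s (k + 1)) (N := ⊥) (fun l hl => by
    simp [(cup_bd_single_and_head_bd_single s k l hl).2, CharTwo.add_self_eq_zero]) hc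
  simpa [CharTwo.add_eq_zero] using this

variable {s}

theorem exists_of_cupList_ne_zero {k : ℕ} {l : List E} (hl : l.length = k + 1)
    (h : cupList s k l ≠ 0) : ∀ i < k, ∃ u ∈ l, ∃ v ∈ l, s i u ≠ s i v := by
  induction k generalizing l with
  | zero => simp
  | succ k ih =>
    match l, hl with
    | a :: b :: r, hl =>
      have h' : (s k a + s k b) * cupList s k (b :: r) ≠ 0 := by
        simpa [cupList, add_mul] using h
      intro i hi
      rcases Nat.lt_succ_iff_lt_or_eq.1 hi with hi | rfl
      · obtain ⟨u, hu, v, hv, huv⟩ := ih (by simpa using hl) (right_ne_zero_of_mul h') i hi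
        exact ⟨u, List.mem_cons_of_mem _ hu, v, List.mem_cons_of_mem _ hv, huv⟩
      · refine ⟨a, by simp, b, by simp, fun hab => left_ne_zero_of_mul h' ?_⟩
        rw [hab, CharTwo.add_self_eq_zero]

/-- The simplices whose vertices lie in the region where `f` reverses every sign function. -/
def Reversed (s : ℕ → E → ZMod 2) (f : E → E) (l : List E) : Prop :=
  ∀ x ∈ l, ∀ i, s i (f x) = s i x + 1

theorem cupList_map {f : E → E} (k : ℕ) {l : List E} (h : Reversed s f l)
    (hl : l.length = k + 1) : cupList s k (l.map f) = cupList s k l := by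
  induction k generalizing l with
  | zero => rfl
  | succ k ih =>
    match l, hl with
    | a :: b :: r, hl =>
      have h' : Reversed s f (b :: r) := fun x hx => h x (List.mem_cons_of_mem _ hx)
      have := ih h' (by simpa using hl)
      simp only [List.map_cons, cupList] at this ⊢
      rw [this, h a (by simp), h b (by simp), ← add_mul, ← add_mul, add_add_add_comm,
        CharTwo.add_self_eq_zero, add_zero]

/-- Flipping all signs leaves the changes along edges alone but shifts the leading factor by 1, so
exactly one copy of `cup s k` survives. -/
theorem head_add_head_map {f : E → E} {k : ℕ} {c : Chain E}
    (hc : c ∈ on fun l : List E => l.length = k + 1 ∧ Reversed s f l) :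
    head s k (c + map f c) = cup s k c := by
  have := on_induction (f := head s k + (head s k).comp (map f) + cup s k) (N := ⊥)
    (fun l ⟨h1, h2⟩ => by
      cases l with
      | nil => simp at h1
      | cons a l =>
        have := cupList_map k h2 h1
        simp only [List.map_cons] at this
        simp only [LinearMap.add_apply, LinearMap.comp_apply, map_single, head, cup, lift_single,
          headList, List.map_cons, this, h2 a (by simp), Submodule.mem_bot]
        rw [add_mul, one_mul, ← add_assoc, CharTwo.add_self_eq_zero, zero_add,
          CharTwo.add_self_eq_zero]) hc
  rw [map_add]
  exact CharTwo.add_eq_zero.1 this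

/-- A chain model of the Borsuk–Ulam theorem: in a sequence of chains `h 0, …, h n` like the
hemispheres of a sphere, some simplex of `h n` has a change of each of the `n` sign functions. -/
theorem exists_sign_changes {f : E → E} {n : ℕ} {h : ℕ → Chain E}
    (h0 : ∃ v, h 0 = Finsupp.single [v] 1)
    (hbd : ∀ k < n, bd (h (k + 1)) = h k + map f (h k))
    {P : List E → Prop} (hP : ∀ l, P l → Reversed s f l)
    (hon : ∀ k ≤ n, h k ∈ on fun l : List E => l.length = k + 1 ∧ P l) :
    ∃ l, P l ∧ ∀ i < n, ∃ u ∈ l, ∃ v ∈ l, s i u ≠ s i v := by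
  -- Stokes: the value on `h (k + 1)` is the value of `head` on its boundary `h k + map f (h k)`,
  -- which is the value of `cup s k` on `h k`.
  have h1 : ∀ k ≤ n, cup s k (h k) = 1 := by
    intro k hk
    induction k with
    | zero =>
      obtain ⟨v, hv⟩ := h0
      simp [hv, cup, cupList]
    | succ k ih =>
      rw [← head_bd s (on_mono (fun l hl => hl.1) (hon _ hk)), hbd k hk,
        head_add_head_map (on_mono (fun l hl => ⟨hl.1, hP l hl.2⟩) (hon k (by omega))), ih (by omega)]
  by_contra! hcon
  have := on_induction (f := cup s n) (N := ⊥) (fun l ⟨h2, h3⟩ => by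
    rw [Submodule.mem_bot, cup, lift_single]
    by_contra h4
    obtain ⟨i, hi, h5⟩ := hcon l h3
    obtain ⟨u, hu, v, hv, huv⟩ := exists_of_cupList_ne_zero h2 h4 i hi
    exact huv (h5 u hu v hv)) (hon n le_rfl)
  rw [Submodule.mem_bot, h1 n le_rfl] at this
  exact one_ne_zero this

end Chain

namespace Chain

/-! ### Barycentric subdivision of chains -/

section Subdivision

variable {E : Type*} [AddCommGroup E] [Module ℝ E]

/-- The barycenter of a simplex. -/
noncomputable def barycenter (l : List E) : E := (l.length : ℝ)⁻¹ • l.sum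

theorem barycenter_map (f : E →ₗ[ℝ] E) (l : List E) :
    barycenter (l.map f) = f (barycenter l) := by
  simp [barycenter, map_list_sum]

/-- Barycentric subdivision of chains of simplices with `k` vertices. -/
noncomputable def sd : ℕ → Chain E →ₗ[ZMod 2] Chain E
  | 0 => LinearMap.id
  | k + 1 => lift fun l => cone (barycenter l) (sd k (bd (Finsupp.single l 1)))

theorem sd_succ_single (k : ℕ) (l : List E) : sd (k + 1) (Finsupp.single l 1) =
    cone (barycenter l) (sd k (bd (Finsupp.single l 1))) := by
  simp [sd]

theorem bd_sd (k : ℕ) (c : Chain E) : bd (sd (k + 1) c) = sd k (bd c) := by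
  have : bd.comp (sd (k + 1)) = (sd k).comp (bd : Chain E →ₗ[ZMod 2] Chain E) := by
    refine hom_ext fun l => ?_
    rw [LinearMap.comp_apply, LinearMap.comp_apply, sd_succ_single, bd_cone]
    suffices bd (sd k (bd (Finsupp.single l 1))) = 0 by simp [this]
    cases k with
    | zero => exact bd_bd _
    | succ k => rw [bd_sd k, bd_bd, map_zero]
  exact LinearMap.congr_fun this c

theorem map_sd (f : E →ₗ[ℝ] E) (k : ℕ) (c : Chain E) : map f (sd k c) = sd k (map f c) := by
  induction k generalizing c with
  | zero => rfl
  | succ k ih =>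
    have : (map f).comp (sd (k + 1)) = (sd (k + 1)).comp (map f) := by
      refine hom_ext fun l => ?_
      rw [LinearMap.comp_apply, LinearMap.comp_apply, sd_succ_single, map_cone, ih, map_bd,
        map_single, sd_succ_single, barycenter_map]
    exact LinearMap.congr_fun this c

theorem bd_sd_iterate (k m : ℕ) (c : Chain E) :
    bd ((sd (k + 1))^[m] c) = (sd k)^[m] (bd c) := by
  induction m generalizing c with
  | zero => rfl
  | succ m ih => rw [Function.iterate_succ_apply, Function.iterate_succ_apply, ih, bd_sd]

theorem map_sd_iterate (f : E →ₗ[ℝ] E) (k m : ℕ) (c : Chain E) :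
    map f ((sd k)^[m] c) = (sd k)^[m] (map f c) := by
  induction m generalizing c with
  | zero => rfl
  | succ m ih => rw [Function.iterate_succ_apply, Function.iterate_succ_apply, ih, map_sd]

theorem sd_iterate_add (k m : ℕ) (c d : Chain E) :
    (sd k)^[m] (c + d) = (sd k)^[m] c + (sd k)^[m] d := by
  rw [← Module.End.coe_pow, map_add]

theorem sd_iterate_single_vertex (m : ℕ) (v : E) :
    (sd 1)^[m] (Finsupp.single [v] 1) = Finsupp.single [v] 1 := by
  induction m with
  | zero => rfl
  | succ m ih =>
    rw [Function.iterate_succ_apply, sd_succ_single, bd_single_cons]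
    simpa [sd, barycenter] using ih

theorem barycenter_mem {l : List E} (hl : l ≠ []) {C : Set E} (hC : Convex ℝ C)
    (h : ∀ x ∈ l, x ∈ C) : barycenter l ∈ C := by
  have h0 : (l.length : ℝ) ≠ 0 := by simpa using hl
  have : barycenter l = ∑ i : Fin l.length, (l.length : ℝ)⁻¹ • l[(i : ℕ)] := by
    rw [← Finset.smul_sum, barycenter, Fin.sum_univ_getElem]
  rw [this]
  refine hC.sum_mem (fun _ _ => by positivity) ?_ fun i _ => h _ (List.getElem_mem _)
  simp [h0]

end Subdivision

/-! ### The mesh of iterated subdivisions -/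

section Mesh

variable {E : Type*} [NormedAddCommGroup E] [NormedSpace ℝ E]

theorem norm_sum_sub_le {l : List E} {x : E} {d : ℝ} (h : ∀ y ∈ l, dist y x ≤ d) :
    ‖l.sum - (l.length : ℝ) • x‖ ≤ l.length * d := by
  induction l with
  | nil => simp
  | cons a l ih =>
    have h1 := ih fun y hy => h y (List.mem_cons_of_mem _ hy)
    have h2 := h a (by simp)
    rw [dist_eq_norm] at h2
    have : (a :: l).sum - ((a :: l).length : ℝ) • x =
        (a - x) + (l.sum - (l.length : ℝ) • x) := by
      simp only [List.sum_cons, List.length_cons]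
      push_cast
      module
    rw [this]
    refine (norm_add_le _ _).trans ?_
    simp only [List.length_cons]
    push_cast
    linarith

/-- In the average of the differences y - x the term y = x vanishes, so only m of the m + 1 terms
contribute, and m / (m + 1) increases with m. -/
theorem dist_barycenter_le {l : List E} {n : ℕ} (hl : l.length ≤ n + 1) {d : ℝ}
    (h : ∀ x ∈ l, ∀ y ∈ l, dist x y ≤ d) {x : E} (hx : x ∈ l) :
    dist (barycenter l) x ≤ n / (n + 1) * d := by
  have hd : 0 ≤ d := (dist_nonneg).trans (h x hx x hx)
  obtain ⟨s, t, rfl⟩ := List.append_of_mem hx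
  have hs := norm_sum_sub_le (l := s ++ t) (x := x) (d := d) fun y hy => h y (by
    simp only [List.mem_append, List.mem_cons] at hy ⊢; tauto) x hx
  set m : ℕ := (s ++ t).length with hm
  have hlen : (s ++ x :: t).length = m + 1 := by simp [hm]; omega
  have hmn : (m : ℝ) ≤ n := by exact_mod_cast (by omega : m ≤ n)
  have : barycenter (s ++ x :: t) - x = ((m : ℝ) + 1)⁻¹ • ((s ++ t).sum - (m : ℝ) • x) := by
    have h1 : ((m : ℝ) + 1) ≠ 0 := by positivity
    rw [barycenter, hlen]
    have h2 : (s ++ x :: t).sum = (s ++ t).sum + x := by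
      simp only [List.sum_append, List.sum_cons]; abel
    rw [h2, ← smul_right_inj h1, smul_sub, smul_smul, smul_smul]
    push_cast
    rw [mul_inv_cancel₀ h1]
    module
  rw [dist_eq_norm, this, norm_smul, norm_inv, Real.norm_of_nonneg (by positivity)]
  calc ((m : ℝ) + 1)⁻¹ * ‖(s ++ t).sum - (m : ℝ) • x‖
      ≤ ((m : ℝ) + 1)⁻¹ * (m * d) := by gcongr
    _ = m / (m + 1) * d := by ring
    _ ≤ n / (n + 1) * d := by
      gcongr ?_ * d
      rw [div_le_div_iff₀ (by positivity) (by positivity)]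
      linarith

theorem sd_single_mem_on {n k : ℕ} (hk : k ≤ n + 1) {l : List E} (hl : l.length = k) {d : ℝ}
    (h : ∀ x ∈ l, ∀ y ∈ l, dist x y ≤ d) {C : Set E} (hC : Convex ℝ C) (hlC : ∀ x ∈ l, x ∈ C) :
    sd k (Finsupp.single l 1) ∈ on fun t : List E => t.length = k ∧ (∀ x ∈ t, x ∈ C) ∧
      ∀ x ∈ t, ∀ y ∈ t, dist x y ≤ n / (n + 1) * d := by
  induction k generalizing l C with
  | zero =>
    obtain rfl := List.eq_nil_of_length_eq_zero hl
    exact single_mem_on (by simp)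
  | succ k ih =>
    rw [sd_succ_single]
    have hne : l ≠ [] := by rintro rfl; simp at hl
    -- Intersecting the convex set with a ball about the barycenter lets the induction on faces also
    -- bound the new edges issuing from the apex.
    refine cone_mem_on (P := fun t : List E => t.length = k ∧
      (∀ x ∈ t, x ∈ C ∩ Metric.closedBall (barycenter l) (n / (n + 1) * d)) ∧
      ∀ x ∈ t, ∀ y ∈ t, dist x y ≤ n / (n + 1) * d) ?_ ?_
    · rintro t ⟨h1, h2, h3⟩
      have hd : 0 ≤ (n : ℝ) / (n + 1) * d := by
        have : 0 ≤ d := by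
          obtain ⟨x, hx⟩ := List.exists_mem_of_ne_nil _ hne
          exact dist_nonneg.trans (h x hx x hx)
        positivity
      refine ⟨by simp [h1], ?_, ?_⟩
      · simp only [List.mem_cons, forall_eq_or_imp]
        exact ⟨barycenter_mem hne hC hlC, fun x hx => (h2 x hx).1⟩
      · simp only [List.mem_cons, forall_eq_or_imp, dist_self]
        refine ⟨⟨hd, fun y hy => ?_⟩, fun x hx => ⟨(h2 x hx).2, h3 x hx⟩⟩
        rw [dist_comm]
        exact (h2 y hy).2
    · refine on_induction ?_ (bd_single_mem_on l)
      rintro t ⟨h1, h2⟩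
      exact ih (by omega) (by omega) (fun x hx y hy => h x (h2 hx) y (h2 hy))
        (hC.inter (convex_closedBall _ _)) fun x hx => ⟨hlC x (h2 hx), by
          rw [Metric.mem_closedBall, dist_comm]
          exact dist_barycenter_le (by omega) h (h2 hx)⟩

theorem sd_iterate_mem_on {n k : ℕ} (hk : k ≤ n + 1) {𝒞 : Set (Set E)}
    (h𝒞 : ∀ C ∈ 𝒞, Convex ℝ C) {d : ℝ} {c : Chain E}
    (hc : c ∈ on fun l : List E => l.length = k ∧ (∃ C ∈ 𝒞, ∀ x ∈ l, x ∈ C) ∧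
      ∀ x ∈ l, ∀ y ∈ l, dist x y ≤ d) (m : ℕ) :
    (sd k)^[m] c ∈ on fun l : List E => l.length = k ∧ (∃ C ∈ 𝒞, ∀ x ∈ l, x ∈ C) ∧
      ∀ x ∈ l, ∀ y ∈ l, dist x y ≤ (n / (n + 1)) ^ m * d := by
  induction m with
  | zero => simpa using hc
  | succ m ih =>
    rw [Function.iterate_succ_apply']
    refine on_induction ?_ ih
    rintro l ⟨h1, ⟨C, hC, h2⟩, h3⟩
    refine on_mono ?_ (sd_single_mem_on hk h1 h3 (h𝒞 C hC) h2)
    rintro t ⟨h4, h5, h6⟩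
    exact ⟨h4, ⟨C, hC, h5⟩, by rwa [pow_succ', mul_assoc]⟩

end Mesh

/-! ### The cross-polytope -/

section CrossPolytope

variable {E : Type*} [AddCommGroup E] (p : ℕ → E)

/-- The boundary of the cross-polytope with vertices `± p i`, `i < k`. -/
noncomputable def sphere : ℕ → Chain E
  | 0 => Finsupp.single [] 1
  | k + 1 => cone (p k) (sphere k) + cone (-p k) (sphere k)

/-- A hemisphere of the boundary of the cross-polytope. -/
noncomputable def hemisphere (k : ℕ) : Chain E := cone (p k) (sphere p k)

theorem map_neg_sphere (k : ℕ) : map Neg.neg (sphere p k) = sphere p k := by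
  induction k with
  | zero => simp [sphere]
  | succ k ih => rw [sphere, map_add, map_cone, map_cone, ih, neg_neg, add_comm]

theorem sphere_succ (k : ℕ) :
    sphere p (k + 1) = hemisphere p k + map Neg.neg (hemisphere p k) := by
  rw [hemisphere, map_cone, map_neg_sphere, sphere]

theorem bd_sphere (k : ℕ) : bd (sphere p k) = 0 := by
  induction k with
  | zero => simp [sphere]
  | succ k ih => simp [sphere, bd_cone, ih, add_self_eq_zero]

theorem bd_hemisphere_succ (k : ℕ) :
    bd (hemisphere p (k + 1)) = hemisphere p k + map Neg.neg (hemisphere p k) := by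
  rw [hemisphere, bd_cone, bd_sphere, map_zero, add_zero, sphere_succ]

/-- The simplices spanned by vectors `± p i`, `i < k`, with at most one sign for each `i`. -/
def IsCrossFace (k : ℕ) (l : List E) : Prop :=
  ∃ ε : ℕ → ℤˣ, ∀ x ∈ l, ∃ j < k, x = (ε j : ℤ) • p j

variable {p} in
theorem IsCrossFace.cons {k : ℕ} {l : List E} (h : IsCrossFace p k l) (u : ℤˣ) :
    IsCrossFace p (k + 1) (((u : ℤ) • p k) :: l) := by
  obtain ⟨ε, hε⟩ := h
  refine ⟨Function.update ε k u, ?_⟩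
  simp only [List.mem_cons, forall_eq_or_imp]
  refine ⟨⟨k, by omega, by simp⟩, fun x hx => ?_⟩
  obtain ⟨j, hj, rfl⟩ := hε x hx
  exact ⟨j, by omega, by rw [Function.update_of_ne hj.ne]⟩

theorem sphere_mem_on (k : ℕ) :
    sphere p k ∈ on fun l : List E => l.length = k ∧ IsCrossFace p k l := by
  induction k with
  | zero => exact single_mem_on ⟨rfl, 1, by simp⟩
  | succ k ih =>
    refine add_mem (cone_mem_on ?_ ih) (cone_mem_on ?_ ih)
    · rintro l ⟨h1, h2⟩
      exact ⟨by simp [h1], by simpa using h2.cons 1⟩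
    · rintro l ⟨h1, h2⟩
      exact ⟨by simp [h1], by simpa using h2.cons (-1)⟩

theorem hemisphere_mem_on (k : ℕ) :
    hemisphere p k ∈ on fun l : List E => l.length = k + 1 ∧ IsCrossFace p (k + 1) l := by
  refine cone_mem_on ?_ (sphere_mem_on p k)
  rintro l ⟨h1, h2⟩
  exact ⟨by simp [h1], by simpa using h2.cons 1⟩

end CrossPolytope

end Chain

/-! ### The Borsuk–Ulam theorem on the ℓ¹ sphere -/

section BorsukUlam

/-- A well-ordering selects one of x and -x. Continuity plays no role: the function only breaks ties
at zeros of coordinates. -/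
theorem exists_odd_sign {V : Type*} [AddCommGroup V] [IsAddTorsionFree V] :
    ∃ σ : V → ZMod 2, ∀ x, x ≠ 0 → σ (-x) = σ x + 1 := by
  classical
  refine ⟨fun x => if WellOrderingRel x (-x) then 1 else 0, fun x hx => ?_⟩
  rcases trichotomous_of WellOrderingRel x (-x) with h | h | h
  · have h' := asymm h
    simp only [neg_neg, h, h', if_true, if_false]
    decide
  · exact absurd (self_eq_neg.1 h) hx
  · have h' := asymm h
    simp only [neg_neg, h, h', if_true, if_false]
    decide

/-- The facet of the unit sphere of the `ℓ¹` norm with signs `ε`. -/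
def crossFacet (m : ℕ) (ε : Fin m → ℝ) : Set (Fin m → ℝ) :=
  {x | ∑ i, ε i * x i = 1 ∧ ∀ i, 0 ≤ ε i * x i}

theorem convex_crossFacet (m : ℕ) (ε : Fin m → ℝ) : Convex ℝ (crossFacet m ε) := by
  rintro x ⟨hx1, hx2⟩ y ⟨hy1, hy2⟩ a b ha hb hab
  have h : ∀ i, ε i * (a • x + b • y) i = a * (ε i * x i) + b * (ε i * y i) := fun i => by
    simp only [Pi.add_apply, Pi.smul_apply, smul_eq_mul]; ring
  refine ⟨?_, fun i => ?_⟩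
  · simp_rw [h, Finset.sum_add_distrib, ← Finset.mul_sum, hx1, hy1]
    linarith
  · rw [h]
    exact add_nonneg (mul_nonneg ha (hx2 i)) (mul_nonneg hb (hy2 i))

theorem sum_abs_of_mem_crossFacet {m : ℕ} {ε : Fin m → ℝ} (hε : ∀ i, |ε i| = 1)
    {x : Fin m → ℝ} (hx : x ∈ crossFacet m ε) : ∑ i, |x i| = 1 := by
  rw [← hx.1]
  refine Finset.sum_congr rfl fun i _ => ?_
  rw [← abs_of_nonneg (hx.2 i), abs_mul, hε, one_mul]

theorem isCompact_sum_abs_eq_one (m : ℕ) : IsCompact {x : Fin m → ℝ | ∑ i, |x i| = 1} := by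
  refine (isCompact_univ_pi fun _ : Fin m => isCompact_Icc (a := (-1 : ℝ)) (b := 1)).of_isClosed_subset
    (isClosed_eq (by fun_prop) (by fun_prop)) ?_
  intro x hx i _
  rw [Set.mem_Icc, ← abs_le, ← (show ∑ i, |x i| = 1 from hx)]
  exact Finset.single_le_sum (f := fun i => |x i|) (fun _ _ => abs_nonneg _) (Finset.mem_univ i)

/-- The unit vectors, indexed by natural numbers. -/
def unitVec (m k : ℕ) : Fin m → ℝ := fun j => if (j : ℕ) = k then 1 else 0

theorem unitVec_mem_crossFacet {m k : ℕ} (hk : k < m) (ε : ℕ → ℤˣ) :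
    ((ε k : ℤ) • unitVec m k) ∈ crossFacet m fun i => ((ε i : ℤ) : ℝ) := by
  have h : ∀ i : Fin m, ((ε i : ℤ) : ℝ) * ((ε k : ℤ) • unitVec m k) i =
      if i = ⟨k, hk⟩ then 1 else 0 := fun i => by
    by_cases hi : (i : ℕ) = k
    · have h1 : (((ε k : ℤ) : ℝ)) * ((ε k : ℤ) : ℝ) = 1 := by
        exact_mod_cast Int.units_coe_mul_self (ε k)
      simp [unitVec, hi, Fin.ext_iff, h1]
    · simp [unitVec, hi, Fin.ext_iff]
  refine ⟨by simp_rw [h]; simp, fun i => ?_⟩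
  simp only [h]
  split_ifs <;> norm_num

/-- The **Borsuk–Ulam theorem** on the unit sphere of the `ℓ¹` norm: an odd continuous map to a
space of smaller dimension has a zero. -/
theorem borsukUlam (n : ℕ) (F : (Fin (n + 1) → ℝ) → Fin n → ℝ)
    (hF : ContinuousOn F {x | ∑ i, |x i| = 1})
    (hodd : ∀ x, ∑ i, |x i| = 1 → F (-x) = -F x) : ∃ x, ∑ i, |x i| = 1 ∧ F x = 0 := by
  classical
  by_contra! hne
  have hK := isCompact_sum_abs_eq_one (n + 1)
  set K : Set (Fin (n + 1) → ℝ) := {x | ∑ i, |x i| = 1} with hKdef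
  have hKne : K.Nonempty := ⟨unitVec (n + 1) 0, sum_abs_of_mem_crossFacet (ε := fun _ => 1)
    (by simp) (by simpa using unitVec_mem_crossFacet (m := n + 1) (k := 0) (by omega) 1)⟩
  obtain ⟨x₀, hx₀, hmin⟩ := hK.exists_isMinOn hKne hF.norm
  have hδ : 0 < ‖F x₀‖ := norm_pos_iff.2 (hne x₀ hx₀)
  set δ := ‖F x₀‖
  obtain ⟨η, hη, hunif⟩ := Metric.uniformContinuousOn_iff.1
    (hK.uniformContinuousOn_of_continuous hF) δ hδ
  obtain ⟨σ, hσ⟩ := exists_odd_sign (V := Fin (n + 1) → ℝ)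
  -- With σ at zeros of the coordinate, and for all i ≥ n, every `s i` is reversed by negation on
  -- the whole sphere.
  let s : ℕ → (Fin (n + 1) → ℝ) → ZMod 2 := fun i x =>
    if hi : i < n then if F x ⟨i, hi⟩ = 0 then σ x else if 0 < F x ⟨i, hi⟩ then 1 else 0 else σ x
  have hs : ∀ x ∈ K, ∀ i, s i (-x) = s i x + 1 := by
    intro x hx i
    have hx0 : x ≠ 0 := by
      rintro rfl
      simp [hKdef] at hx
    simp only [s, hodd x hx, Pi.neg_apply, neg_eq_zero, hσ x hx0]
    split_ifs with h1 h2 h3 h4 h4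
    · rfl
    · linarith
    · simp
    · decide
    · exact absurd (le_antisymm (not_lt.1 h4) (by linarith)) h2
    · rfl
  -- A change of `s i` means that the i-th coordinate of F does not keep one strict sign on l, so it
  -- is below δ in absolute value at any vertex x. Having this for all i contradicts the minimality
  -- of δ.
  have hzero : ∀ l : List (Fin (n + 1) → ℝ), (∀ x ∈ l, x ∈ K) →
      (∀ x ∈ l, ∀ y ∈ l, dist x y < η) → ¬ ∀ i < n, ∃ u ∈ l, ∃ v ∈ l, s i u ≠ s i v := by
    intro l hlK hlη hch
    have hn : 0 < n := by
      by_contra h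
      obtain rfl : n = 0 := by omega
      exact hne x₀ hx₀ (Subsingleton.elim _ _)
    obtain ⟨x, hx, -⟩ := hch 0 hn
    have hlt : ‖F x‖ < δ := by
      rw [pi_norm_lt_iff hδ]
      rintro ⟨i, hi⟩
      obtain ⟨u, hu, v, hv, huv⟩ := hch i hi
      have hdist : ∀ y ∈ l, |F x ⟨i, hi⟩ - F y ⟨i, hi⟩| < δ := fun y hy =>
        (dist_le_pi_dist (F x) (F y) ⟨i, hi⟩).trans_lt
          (hunif x (hlK x hx) y (hlK y hy) (hlη x hx y hy))
      have hu' := abs_lt.1 (hdist u hu)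
      have hv' := abs_lt.1 (hdist v hv)
      rw [Real.norm_eq_abs, abs_lt]
      simp only [s, hi, dif_pos] at huv
      split_ifs at huv <;> first | exact absurd rfl huv | constructor <;> linarith
    exact absurd (hmin (hlK x hx)) (not_le.2 hlt)
  obtain ⟨m, hm⟩ := exists_pow_lt_of_lt_one (show 0 < η / 2 by positivity)
    (show (n : ℝ) / (n + 1) < 1 by rw [div_lt_one (by positivity)]; linarith)
  -- Each simplex lies in a convex facet, so subdivision never leaves the ℓ¹ sphere and no radial
  -- projection is needed.
  let 𝒞 : Set (Set (Fin (n + 1) → ℝ)) :=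
    {C | ∃ ε : ℕ → ℤˣ, C = crossFacet (n + 1) fun i => ((ε i : ℤ) : ℝ)}
  have h𝒞 : ∀ C ∈ 𝒞, Convex ℝ C := by
    rintro _ ⟨ε, rfl⟩
    exact convex_crossFacet _ _
  have h𝒞K : ∀ C ∈ 𝒞, C ⊆ K := by
    rintro _ ⟨ε, rfl⟩ x hx
    exact sum_abs_of_mem_crossFacet (fun i => by
      exact_mod_cast Int.isUnit_iff_abs_eq.1 (ε i).isUnit) hx
  have hKdist : ∀ x ∈ K, ∀ y ∈ K, dist x y ≤ 2 := by
    have h1 : ∀ x ∈ K, ‖x‖ ≤ 1 := fun x hx => by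
      rw [pi_norm_le_iff_of_nonneg zero_le_one]
      intro i
      rw [← (show ∑ i, |x i| = 1 from hx)]
      exact Finset.single_le_sum (f := fun i => |x i|) (fun _ _ => abs_nonneg _)
        (Finset.mem_univ i)
    intro x hx y hy
    rw [dist_eq_norm]
    linarith [norm_sub_le x y, h1 x hx, h1 y hy]
  let p := unitVec (n + 1)
  obtain ⟨l, ⟨⟨C, hC, hlC⟩, hl⟩, hch⟩ := Chain.exists_sign_changes (s := s) (f := Neg.neg) (n := n)
    (h := fun k => (Chain.sd (k + 1))^[m] (Chain.hemisphere p k))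
    (P := fun l => (∃ C ∈ 𝒞, ∀ x ∈ l, x ∈ C) ∧
      ∀ x ∈ l, ∀ y ∈ l, dist x y ≤ (n / (n + 1)) ^ m * 2)
    ⟨p 0, by simp [Chain.hemisphere, Chain.sphere, Chain.sd_iterate_single_vertex]⟩
    (fun k _ => by
      rw [Chain.bd_sd_iterate, Chain.bd_hemisphere_succ, Chain.sd_iterate_add]
      exact congrArg _ (Chain.map_sd_iterate (-LinearMap.id) (k + 1) m _).symm)
    (by
      rintro l ⟨⟨C, hC, hlC⟩, -⟩ x hx
      exact hs x (h𝒞K C hC (hlC x hx)))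
    (by
      intro k hk
      refine Chain.sd_iterate_mem_on (by omega) h𝒞 (Chain.on_mono ?_ (Chain.hemisphere_mem_on p k)) m
      rintro l ⟨h1, ε, h2⟩
      have h3 : ∀ x ∈ l, x ∈ crossFacet (n + 1) fun i => ((ε i : ℤ) : ℝ) := by
        intro x hx
        obtain ⟨j, hj, rfl⟩ := h2 x hx
        exact unitVec_mem_crossFacet (by omega) ε
      have h4 : ∀ x ∈ l, x ∈ K := fun x hx => h𝒞K _ ⟨ε, rfl⟩ (h3 x hx)
      exact ⟨h1, ⟨_, ⟨ε, rfl⟩, h3⟩, fun x hx y hy => hKdist x (h4 x hx) y (h4 y hy)⟩)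
  refine hzero l (fun x hx => h𝒞K C hC (hlC x hx)) (fun x hx y hy => (hl x hx y hy).trans_lt ?_) hch
  linarith

end BorsukUlam

/-! ### Zero-free extension by general position -/

section Extension

open Set in
/-- A continuous map without zeros on a compact set extends continuously so that it has no zeros on
the range of a linear map from a space of smaller dimension than the target. -/
theorem exists_continuous_extension_ne_zero {V W F : Type*}
    [NormedAddCommGroup V] [NormedSpace ℝ V] [FiniteDimensional ℝ V]
    [NormedAddCommGroup W] [NormedSpace ℝ W] [FiniteDimensional ℝ W]
    [NormedAddCommGroup F] [NormedSpace ℝ F] [FiniteDimensional ℝ F]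
    (ι : W →ₗ[ℝ] V) (hWF : Module.finrank ℝ W < Module.finrank ℝ F) {A : Set V}
    (hA : IsCompact A) {f : V → F} (hf : ContinuousOn f A) (hne : ∀ x ∈ A, f x ≠ 0) :
    ∃ G : V → F, Continuous G ∧ EqOn G f A ∧ ∀ y, G (ι y) ≠ 0 := by
  have : TietzeExtension F := TietzeExtension.of_tvs ℝ
  obtain ⟨F₀, hF₀⟩ := ContinuousMap.exists_restrict_eq hA.isClosed
    ⟨A.domRestrict f, continuousOn_iff_continuous_domRestrict.1 hf⟩
  have hF₀A : ∀ x ∈ A, F₀ x = f x := fun x hx => congrArg (fun g => g ⟨x, hx⟩) hF₀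
  obtain ⟨δ, hδ, hδA⟩ : ∃ δ > 0, ∀ x ∈ A, 2 * δ ≤ ‖f x‖ := by
    rcases A.eq_empty_or_nonempty with rfl | hAne
    · exact ⟨1, one_pos, by simp⟩
    · obtain ⟨x₀, hx₀, hmin⟩ := hA.exists_isMinOn hAne hf.norm
      have := norm_pos_iff.2 (hne x₀ hx₀)
      refine ⟨‖f x₀‖ / 2, by positivity, fun x hx => ?_⟩
      have h1 : ‖f x₀‖ ≤ ‖f x‖ := hmin hx
      linarith
  obtain ⟨g, hg, hgF, -⟩ := F₀.continuous.exists_contDiff_approx 1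
    (ε := fun _ => δ / 2) continuous_const fun _ => by positivity
  -- A C¹ image of a lower-dimensional space has dense complement; subtracting a small omitted value
  -- c from g removes its zeros on the range of ι.
  have hdense := (hg.comp ι.toContinuousLinearMap.contDiff).dense_compl_range_of_finrank_lt_finrank
    hWF
  obtain ⟨c, hc, hcδ⟩ := hdense.exists_dist_lt (0 : F) (ε := δ / 2) (by positivity)
  have hP : ∀ x, ‖g x - c - F₀ x‖ < δ := fun x => by
    have h1 := hgF x
    rw [dist_eq_norm] at h1
    rw [dist_zero_left] at hcδ
    calc ‖g x - c - F₀ x‖ = ‖(g x - F₀ x) - c‖ := by congr 1; abel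
      _ ≤ ‖g x - F₀ x‖ + ‖c‖ := norm_sub_le _ _
      _ < δ := by linarith
  -- This cutoff is 1 where ‖F₀‖ ≤ δ, where the result is g - c, and 0 where ‖F₀‖ ≥ 2δ, in
  -- particular on A. Where ‖F₀‖ > δ, the correction, of norm less than δ, cannot cancel F₀.
  let χ : V → ℝ := fun x => max 0 (min 1 (2 - ‖F₀ x‖ / δ))
  have hχ0 : ∀ x, 0 ≤ χ x := fun x => le_max_left _ _
  have hχ1 : ∀ x, χ x ≤ 1 := fun x => max_le zero_le_one (min_le_left _ _)
  refine ⟨fun x => F₀ x + χ x • (g x - c - F₀ x), ?_, fun x hx => ?_, fun y => ?_⟩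
  · have := hg.continuous
    fun_prop
  · have : χ x = 0 := by
      refine max_eq_left ((min_le_right _ _).trans ?_)
      have := hδA x hx
      rw [sub_nonpos, le_div_iff₀ hδ, hF₀A x hx]
      exact this
    simp [this, hF₀A x hx]
  · set x := ι y
    rcases le_or_gt ‖F₀ x‖ δ with h | h
    · have : χ x = 1 := by
        have h1 : ‖F₀ x‖ / δ ≤ 1 := (div_le_one hδ).2 h
        simp only [χ]
        rw [min_eq_left (by linarith), max_eq_right zero_le_one]
      intro h2
      dsimp only at h2
      rw [this, one_smul] at h2
      refine hc ⟨y, ?_⟩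
      rw [add_sub_cancel, sub_eq_zero] at h2
      exact h2
    · intro h2
      have h3 : F₀ x = -(χ x • (g x - c - F₀ x)) := eq_neg_of_add_eq_zero_left h2
      have h4 : ‖F₀ x‖ ≤ δ := by
        rw [h3, norm_neg, norm_smul, Real.norm_of_nonneg (hχ0 x)]
        calc χ x * ‖g x - c - F₀ x‖ ≤ 1 * δ :=
              mul_le_mul (hχ1 x) (hP x).le (norm_nonneg _) zero_le_one
          _ = δ := one_mul _
      exact absurd h4 (not_le.2 h)

end Extension

/-! ### Equivariant maps from hemispheres -/

section Gluing

open Set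

/-- The unit sphere of the `ℓ¹` norm in the span of the first `k` coordinate vectors. -/
def crossSphere (m k : ℕ) : Set (Fin m → ℝ) :=
  {x | ∑ i, |x i| = 1 ∧ ∀ i : Fin m, k ≤ i → x i = 0}

/-- The unit ball of the `ℓ¹` norm in the span of the first `k` coordinate vectors. -/
def crossBall (m k : ℕ) : Set (Fin m → ℝ) :=
  {x | ∑ i, |x i| ≤ 1 ∧ ∀ i : Fin m, k ≤ i → x i = 0}

theorem crossSphere_subset_crossBall (m k : ℕ) : crossSphere m k ⊆ crossBall m k :=
  fun _ hx => ⟨hx.1.le, hx.2⟩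

theorem isCompact_crossSphere (m k : ℕ) : IsCompact (crossSphere m k) := by
  refine (isCompact_sum_abs_eq_one m).of_isClosed_subset ?_ fun x hx => hx.1
  have : crossSphere m k = {x | ∑ i, |x i| = 1} ∩ ⋂ i : Fin m, ⋂ _ : k ≤ i, {x | x i = 0} := by
    ext x; simp [crossSphere]
  rw [this]
  exact (isCompact_sum_abs_eq_one m).isClosed.inter
    (isClosed_iInter fun i => isClosed_iInter fun _ => isClosed_eq (by fun_prop) (by fun_prop))

theorem crossSphere_zero (m : ℕ) : crossSphere m 0 = ∅ := by
  refine eq_empty_of_forall_notMem fun x hx => ?_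
  have := hx.1
  simp [fun i => hx.2 i (Nat.zero_le _)] at this

/-- Replace the coordinate with index `k` by zero. -/
def dropCoord (m k : ℕ) (x : Fin m → ℝ) : Fin m → ℝ := fun i => if (i : ℕ) = k then 0 else x i

theorem continuous_dropCoord (m k : ℕ) : Continuous (dropCoord m k) := by
  refine continuous_pi fun i => ?_
  simp only [dropCoord]
  split_ifs <;> fun_prop

theorem dropCoord_neg (m k : ℕ) (x : Fin m → ℝ) : dropCoord m k (-x) = -dropCoord m k x := by
  ext i
  simp only [dropCoord, Pi.neg_apply]
  split_ifs <;> simp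

theorem dropCoord_mem {m k : ℕ} {x : Fin m → ℝ} (hx : x ∈ crossSphere m (k + 1)) :
    dropCoord m k x ∈ crossBall m k := by
  refine ⟨?_, fun i hi => ?_⟩
  · rw [← hx.1]
    refine Finset.sum_le_sum fun i _ => ?_
    simp only [dropCoord]
    split_ifs <;> simp
  · simp only [dropCoord]
    split_ifs with h
    · rfl
    · exact hx.2 i (by omega)

theorem neg_mem_crossBall {m k : ℕ} {x : Fin m → ℝ} (hx : x ∈ crossBall m k) :
    -x ∈ crossBall m k :=
  ⟨by simpa using hx.1, fun i hi => by simpa using hx.2 i hi⟩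

theorem mem_crossSphere_of_apply_eq_zero {m k : ℕ} (hk : k < m) {x : Fin m → ℝ}
    (hx : x ∈ crossSphere m (k + 1)) (h : x ⟨k, hk⟩ = 0) :
    x ∈ crossSphere m k ∧ dropCoord m k x = x := by
  refine ⟨⟨hx.1, fun i hi => ?_⟩, ?_⟩
  · rcases hi.eq_or_lt with h1 | h1
    · rwa [show i = ⟨k, hk⟩ from Fin.ext h1.symm]
    · exact hx.2 i h1
  · ext i
    simp only [dropCoord]
    split_ifs with h1
    · rw [show i = ⟨k, hk⟩ from Fin.ext h1, h]
    · rfl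

/-- A map on a ball which is equivariant on the boundary sphere gives, by reflection, an equivariant
map on the sphere of which the ball is a hemisphere. -/
theorem exists_equivariant_of_hemisphere {Y : Type*} [TopologicalSpace Y] {m k : ℕ} (hk : k < m)
    {Y₀ : Set Y} {τ : Y → Y} (hτ : ContinuousOn τ Y₀) (hτ₀ : MapsTo τ Y₀ Y₀)
    (hττ : ∀ y ∈ Y₀, τ (τ y) = y) {G : (Fin m → ℝ) → Y} (hG : ContinuousOn G (crossBall m k))
    (hG₀ : MapsTo G (crossBall m k) Y₀) (hGτ : ∀ x ∈ crossSphere m k, G (-x) = τ (G x)) :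
    ∃ F : (Fin m → ℝ) → Y, ContinuousOn F (crossSphere m (k + 1)) ∧
      MapsTo F (crossSphere m (k + 1)) (Y₀ ∩ (G '' crossBall m k ∪ τ '' (G '' crossBall m k))) ∧
      ∀ x ∈ crossSphere m (k + 1), F (-x) = τ (F x) := by
  classical
  have hup : ContinuousOn (fun x => G (dropCoord m k x)) (crossSphere m (k + 1)) :=
    hG.comp (continuous_dropCoord m k).continuousOn fun x hx => dropCoord_mem hx
  have hdown : ContinuousOn (fun x => τ (G (-dropCoord m k x))) (crossSphere m (k + 1)) :=
    hτ.comp (hG.comp (continuous_dropCoord m k).neg.continuousOn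
      fun x hx => neg_mem_crossBall (dropCoord_mem hx)) fun x hx =>
        hG₀ (neg_mem_crossBall (dropCoord_mem hx))
  have heq : ∀ x ∈ crossSphere m (k + 1), x ⟨k, hk⟩ = 0 →
      G (dropCoord m k x) = τ (G (-dropCoord m k x)) := fun x hx h => by
    obtain ⟨h1, h2⟩ := mem_crossSphere_of_apply_eq_zero hk hx h
    rw [h2, hGτ x h1, hττ _ (hG₀ (crossSphere_subset_crossBall m k h1))]
  -- Both hemispheres project onto the equatorial ball; equivariance dictates the formula on the
  -- lower one.
  refine ⟨fun x => if 0 ≤ x ⟨k, hk⟩ then G (dropCoord m k x) else τ (G (-dropCoord m k x)),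
    ?_, fun x hx => ?_, fun x hx => ?_⟩
  · refine ContinuousOn.if (fun x hx => heq x hx.1 ?_) (hup.mono inter_subset_left)
      (hdown.mono inter_subset_left)
    have : x ∈ {x : Fin m → ℝ | (0 : ℝ) = x ⟨k, hk⟩} :=
      frontier_le_subset_eq continuous_const (continuous_apply _) hx.2
    exact this.symm
  · have h1 := dropCoord_mem hx
    have h2 := neg_mem_crossBall h1
    dsimp only
    split_ifs
    · exact ⟨hG₀ h1, Or.inl ⟨_, h1, rfl⟩⟩
    · exact ⟨hτ₀ (hG₀ h2), Or.inr ⟨_, ⟨_, h2, rfl⟩, rfl⟩⟩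
  · have h1 := hG₀ (neg_mem_crossBall (dropCoord_mem hx))
    dsimp only
    rw [dropCoord_neg, neg_neg, Pi.neg_apply]
    rcases lt_trichotomy (x ⟨k, hk⟩) 0 with h | h | h
    · rw [if_pos (by linarith), if_neg (by linarith), hττ _ h1]
    · rw [if_pos (by linarith), if_pos (by linarith), heq x hx h, hττ _ h1]
    · rw [if_neg (by linarith), if_pos h.le]

end Gluing

/-! ### Borsuk–Ulam for involutions and invariance of the boundary -/

section Involution

open Set Metric

variable {n : ℕ}

/-- The closed unit ball of `ℝⁿ`. -/
abbrev EuclideanBall (n : ℕ) : Type := closedBall (0 : EuclideanSpace ℝ (Fin n)) 1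

/-- The inclusion of the span of the first `k` coordinate vectors. -/
noncomputable def coordInclusion (m k : ℕ) : (Fin k → ℝ) →ₗ[ℝ] (Fin m → ℝ) where
  toFun y i := if h : (i : ℕ) < k then y ⟨i, h⟩ else 0
  map_add' x y := by ext i; simp only [Pi.add_apply]; split_ifs <;> simp
  map_smul' c x := by ext i; simp only [Pi.smul_apply]; split_ifs <;> simp

theorem mem_range_coordInclusion {m k : ℕ} (hk : k ≤ m) {x : Fin m → ℝ}
    (hx : x ∈ crossBall m k) : ∃ y, coordInclusion m k y = x := by
  refine ⟨fun j => x ⟨j, by omega⟩, ?_⟩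
  ext i
  simp only [coordInclusion, LinearMap.coe_mk, AddHom.coe_mk]
  split_ifs with h
  · rfl
  · exact (hx.2 i (by omega)).symm

variable {τ : EuclideanBall n → EuclideanBall n}

/-- Starting from the empty sphere, a map on the boundary of the k-ball with k < n extends over that
ball without zeros in ℝⁿ. Normalizing returns it to the unit sphere, and reflection through τ
produces the next sphere. Fixed points of τ do no harm. -/
theorem exists_equivariant_crossSphere
    (hτ : ContinuousOn τ {u : EuclideanBall n | ‖u.1‖ = 1})
    (hτ₁ : ∀ u : EuclideanBall n, ‖u.1‖ = 1 → ‖(τ u).1‖ = 1)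
    (hττ : ∀ u : EuclideanBall n, ‖u.1‖ = 1 → τ (τ u) = u) {k : ℕ} (hk : k ≤ n) :
    ∃ g : (Fin (n + 1) → ℝ) → EuclideanBall n,
      ContinuousOn g (crossSphere (n + 1) k) ∧
      MapsTo g (crossSphere (n + 1) k) {u : EuclideanBall n | ‖u.1‖ = 1} ∧
      ∀ x ∈ crossSphere (n + 1) k, g (-x) = τ (g x) := by
  induction k with
  | zero => exact ⟨fun _ => ⟨0, by simp⟩, by simp [crossSphere_zero, MapsTo]⟩
  | succ k ih =>
    obtain ⟨g, hg, hg₁, hgτ⟩ := ih (by omega)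
    obtain ⟨G, hG, hGg, hG₀⟩ := exists_continuous_extension_ne_zero (coordInclusion (n + 1) k)
      (F := EuclideanSpace ℝ (Fin n)) (by simpa using hk) (isCompact_crossSphere (n + 1) k)
      (f := fun x => (g x).1) (continuous_subtype_val.comp_continuousOn hg)
      (fun x hx h => by
        have := hg₁ hx
        simp [h] at this)
    have hne : ∀ x ∈ crossBall (n + 1) k, G x ≠ 0 := fun x hx => by
      obtain ⟨y, rfl⟩ := mem_range_coordInclusion (by omega) hx
      exact hG₀ y
    have hnorm : ∀ x, G x ≠ 0 → ‖‖G x‖⁻¹ • G x‖ = 1 := fun x hx => by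
      rw [norm_smul, norm_inv, norm_norm, inv_mul_cancel₀ (norm_ne_zero_iff.2 hx)]
    have hle : ∀ x, ‖‖G x‖⁻¹ • G x‖ ≤ 1 := fun x => by
      by_cases h : G x = 0
      · simp [h]
      · exact (hnorm x h).le
    let G₁ : (Fin (n + 1) → ℝ) → EuclideanBall n := fun x =>
      ⟨‖G x‖⁻¹ • G x, mem_closedBall_zero_iff.2 (hle x)⟩
    have hG₁ : ContinuousOn G₁ (crossBall (n + 1) k) := by
      refine continuousOn_iff_continuous_domRestrict.2 (Continuous.subtype_mk ?_ _)
      exact continuousOn_iff_continuous_domRestrict.1 <| (hG.norm.continuousOn.inv₀ fun x hx => norm_ne_zero_iff.2 (hne x hx)).smul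
        hG.continuousOn
    have hG₁g : ∀ x ∈ crossSphere (n + 1) k, G₁ x = g x := fun x hx => by
      have h1 : ‖(g x).1‖ = 1 := hg₁ hx
      refine Subtype.ext ?_
      simp only [G₁]
      rw [hGg hx, h1, inv_one, one_smul]
    obtain ⟨F, hF, hF₁, hFτ⟩ := exists_equivariant_of_hemisphere (by omega) hτ (fun u => hτ₁ u) hττ
      hG₁ (fun x hx => hnorm x (hne x hx)) fun x hx => by
        have hx' : -x ∈ crossSphere (n + 1) k :=
          ⟨by simpa using hx.1, fun i hi => by simpa using hx.2 i hi⟩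
        rw [hG₁g x hx, hG₁g _ hx', hgτ x hx]
    exact ⟨F, hF, fun x hx => (hF₁ hx).1, hFτ⟩

/-- A **Borsuk–Ulam theorem** for an arbitrary continuous involution of the sphere. -/
theorem exists_zero_of_involution
    (hτ : ContinuousOn τ {u : EuclideanBall n | ‖u.1‖ = 1})
    (hτ₁ : ∀ u : EuclideanBall n, ‖u.1‖ = 1 → ‖(τ u).1‖ = 1)
    (hττ : ∀ u : EuclideanBall n, ‖u.1‖ = 1 → τ (τ u) = u)
    {L : EuclideanBall n → Fin n → ℝ} (hL : Continuous L)
    (hLτ : ∀ u : EuclideanBall n, ‖u.1‖ = 1 → L (τ u) = -L u) : ∃ u, L u = 0 := by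
  obtain ⟨g, hg, hg₁, hgτ⟩ := exists_equivariant_crossSphere hτ hτ₁ hττ le_rfl
  have : TietzeExtension (EuclideanSpace ℝ (Fin n)) := TietzeExtension.of_tvs ℝ
  obtain ⟨G, hG⟩ := ContinuousMap.exists_restrict_eq (isCompact_crossSphere (n + 1) n).isClosed
    ⟨(crossSphere (n + 1) n).domRestrict fun x => (g x).1,
      continuousOn_iff_continuous_domRestrict.1 (continuous_subtype_val.comp_continuousOn hg)⟩
  have hGg : ∀ x ∈ crossSphere (n + 1) n, G x = g x := fun x hx =>
    congrArg (fun g => g ⟨x, hx⟩) hG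
  have hpos : ∀ x, 0 < max 1 ‖G x‖ := fun x => lt_max_of_lt_left one_pos
  -- Radial retraction onto the unit ball, which leaves the values on the cross-sphere unchanged.
  let G₁ : (Fin (n + 1) → ℝ) → EuclideanBall n := fun x =>
    ⟨(max 1 ‖G x‖)⁻¹ • G x, by
      rw [mem_closedBall_zero_iff, norm_smul, norm_inv, Real.norm_of_nonneg (hpos x).le,
        inv_mul_le_one₀ (hpos x)]
      exact le_max_right _ _⟩
  have hG₁ : Continuous G₁ := by
    refine Continuous.subtype_mk ?_ _
    exact ((continuous_const.max G.continuous.norm).inv₀ fun x => (hpos x).ne').smul G.continuous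
  have hG₁g : ∀ x ∈ crossSphere (n + 1) n, G₁ x = g x := fun x hx => by
    refine Subtype.ext ?_
    have h1 : ‖(g x).1‖ = 1 := hg₁ hx
    simp [G₁, hGg x hx, h1]
  -- All values of F are of the form ± L (G₁ y), so a zero of F is a zero of L.
  obtain ⟨F, hF, hF₁, hFodd⟩ := exists_equivariant_of_hemisphere (Y := Fin n → ℝ) (m := n + 1)
    (k := n) (by omega) (Y₀ := univ) (τ := Neg.neg) continuous_neg.continuousOn (mapsTo_univ _ _)
    (fun y _ => neg_neg y) (G := fun x => L (G₁ x)) (hL.comp hG₁).continuousOn (mapsTo_univ _ _)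
    (fun x hx => by
      have hx' : -x ∈ crossSphere (n + 1) n :=
        ⟨by simpa using hx.1, fun i hi => by simpa using hx.2 i hi⟩
      rw [hG₁g x hx, hG₁g _ hx', hgτ x hx, hLτ _ (hg₁ hx)])
  have hS : crossSphere (n + 1) (n + 1) = {x | ∑ i, |x i| = 1} := by
    ext x
    exact ⟨fun h => h.1, fun h => ⟨h, fun i hi => absurd i.2 (by omega)⟩⟩
  rw [hS] at hF hF₁ hFodd
  obtain ⟨x, hx, hx0⟩ := borsukUlam n F hF hFodd
  obtain ⟨-, ⟨y, -, hy⟩ | ⟨_, ⟨y, -, rfl⟩, hy⟩⟩ := hF₁ hx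
  · exact ⟨G₁ y, hy.trans hx0⟩
  · exact ⟨G₁ y, neg_eq_zero.1 (hy.trans hx0)⟩

/-- **Invariance of the boundary** of the ball under homeomorphisms. -/
theorem norm_eq_one_of_homeomorph
    (ψ : EuclideanBall n ≃ₜ EuclideanBall n)
    {q : EuclideanBall n}
    (hq : ‖(ψ q).1‖ = 1) : ‖q.1‖ = 1 := by
  by_contra hq1
  have hball : ∀ u : EuclideanBall n,
      ‖u.1‖ ≤ 1 := fun u => mem_closedBall_zero_iff.1 u.2
  have hlt : 0 < 1 - ‖q.1‖ := sub_pos.2 (lt_of_le_of_ne (hball q) hq1)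
  -- K fixes the sphere. It misses q: K u = q gives ‖u‖ ‖ψ u‖ = ‖ψ q‖ = 1, so ‖u‖ = 1 and u = K u =
  -- q, although q is interior.
  let K : EuclideanBall n → EuclideanBall n :=
    fun u => ψ.symm ⟨‖u.1‖ • (ψ u).1, by
      rw [mem_closedBall_zero_iff, norm_smul, norm_norm]
      exact mul_le_one₀ (hball u) (norm_nonneg _) (hball _)⟩
  have hK : Continuous K := by
    refine ψ.symm.continuous.comp (Continuous.subtype_mk ?_ _)
    exact continuous_subtype_val.norm.smul (continuous_subtype_val.comp ψ.continuous)
  have hK₁ : ∀ u : EuclideanBall n, ‖u.1‖ = 1 → K u = u := fun u hu => by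
    simp only [K, hu, one_smul]
    exact ψ.symm_apply_apply u
  have hKq : ∀ u, K u ≠ q := fun u h => by
    have h1 : ‖u.1‖ * ‖(ψ u).1‖ = 1 := by
      have h2 : (ψ (K u)).1 = ‖u.1‖ • (ψ u).1 := congrArg Subtype.val (ψ.apply_symm_apply _)
      rw [← h, h2, norm_smul, norm_norm] at hq
      exact hq
    have h2 : ‖u.1‖ = 1 := by
      nlinarith [hball u, hball (ψ u), norm_nonneg u.1]
    rw [hK₁ u h2] at h
    exact hq1 (h ▸ h2)
  -- χ vanishes on the sphere, so K u - χ(K u) q is odd there. At a zero ‖K u‖ ≤ ‖q‖, where χ is 1,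
  -- and K u = q follows.
  let χ : EuclideanSpace ℝ (Fin n) → ℝ := fun z =>
    min 1 ((1 - ‖z‖) / (1 - ‖q.1‖))
  have hχ : Continuous χ := continuous_const.min ((continuous_const.sub continuous_norm).div_const _)
  obtain ⟨u, hu⟩ := exists_zero_of_involution (n := n) (τ := fun u => -u) continuous_neg.continuousOn
    (fun u hu => by simpa using hu) (fun u _ => neg_neg u)
    (L := fun u => WithLp.ofLp ((K u).1 -
      χ (K u) • q.1))
    (by
      have := continuous_subtype_val.comp hK
      exact (PiLp.continuous_ofLp 2 _).comp (this.sub ((hχ.comp this).smul continuous_const)))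
    (fun u hu => by
      have h1 : ∀ v : EuclideanBall n,
          ‖v.1‖ = 1 → χ v = 0 := fun v hv => by simp [χ, hv]
      have hu' : ‖(-u : EuclideanBall n).1‖ = 1 := by simpa using hu
      simp only [hK₁ _ hu, hK₁ _ hu', h1 _ hu, h1 _ hu', zero_smul, sub_zero]
      rfl)
  have hu' : (K u).1 = χ (K u) • q.1 :=
    sub_eq_zero.1 ((WithLp.ofLp_eq_zero 2).1 hu)
  have hχ0 : 0 ≤ χ (K u) :=
    le_min zero_le_one (div_nonneg (sub_nonneg.2 (hball _)) hlt.le)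
  have hle : ‖(K u).1‖ ≤ ‖q.1‖ := by
    rw [hu', norm_smul, Real.norm_of_nonneg hχ0]
    exact mul_le_of_le_one_left (norm_nonneg _) (min_le_left _ _)
  have hχ1 : χ (K u) = 1 := min_eq_left ((one_le_div hlt).2 (by linarith))
  rw [hχ1, one_smul] at hu'
  exact hKq u (Subtype.ext hu')

end Involution

/-! ### Barycentric coordinates and homogeneity of open simplices -/

section Realization

set_option linter.unusedSectionVars false

open Set

variable {E : Type*} [NormedAddCommGroup E] [NormedSpace ℝ E]

/-- The function `w` gives barycentric coordinates on the simplex with vertex set `s`. -/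
structure IsWeight (s : Finset E) (w : E → ℝ) : Prop where
  eq_zero : ∀ v, v ∉ s → w v = 0
  nonneg : ∀ v, 0 ≤ w v
  sum_eq : ∑ v ∈ s, w v = 1

theorem IsWeight.sum_eq_of_subset {s t : Finset E} {w : E → ℝ} (hw : IsWeight s w) (hst : s ⊆ t)
    {M : Type*} [AddCommGroup M] [Module ℝ M] (f : E → M) :
    ∑ v ∈ t, w v • f v = ∑ v ∈ s, w v • f v :=
  (Finset.sum_subset hst fun v _ hv => by rw [hw.eq_zero v hv, zero_smul]).symm

theorem IsWeight.mono {s t : Finset E} {w : E → ℝ} (hw : IsWeight s w) (hst : s ⊆ t) :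
    IsWeight t w :=
  ⟨fun v hv => hw.eq_zero v fun h => hv (hst h), hw.nonneg, by
    have := hw.sum_eq_of_subset hst fun _ => (1 : ℝ)
    simpa [hw.sum_eq] using this⟩

theorem mem_convexHull_iff_isWeight {s : Finset E} {x : E} :
    x ∈ convexHull ℝ (s : Set E) ↔ ∃ w, IsWeight s w ∧ ∑ v ∈ s, w v • v = x := by
  classical
  rw [Finset.mem_convexHull']
  constructor
  · rintro ⟨w, h0, h1, h2⟩
    refine ⟨fun v => if v ∈ s then w v else 0, ⟨fun v hv => if_neg hv, fun v => ?_, ?_⟩, ?_⟩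
    · split_ifs with h
      · exact h0 v h
      · exact le_rfl
    · rw [← h1]
      exact Finset.sum_congr rfl fun v hv => if_pos hv
    · rw [← h2]
      exact Finset.sum_congr rfl fun v hv => congrArg (· • v) (if_pos hv)
  · rintro ⟨w, h, rfl⟩
    exact ⟨w, fun v _ => h.nonneg v, h.sum_eq, rfl⟩

theorem isCompact_setOf_isWeight (s : Finset E) : IsCompact {w : E → ℝ | IsWeight s w} := by
  refine (isCompact_univ_pi fun _ : E => isCompact_Icc (a := (0 : ℝ)) (b := 1)).of_isClosed_subset
    ?_ ?_
  · have : {w : E → ℝ | IsWeight s w} = (⋂ v, ⋂ _ : v ∉ s, {w | w v = 0}) ∩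
        ((⋂ v, {w | 0 ≤ w v}) ∩ {w | ∑ v ∈ s, w v = 1}) := by
      ext w
      simp only [mem_inter_iff, mem_iInter, mem_ofPred_eq]
      exact ⟨fun h => ⟨h.1, h.2, h.3⟩, fun h => ⟨h.1, h.2.1, h.2.2⟩⟩
    rw [this]
    refine (isClosed_iInter fun v => isClosed_iInter fun _ => ?_).inter
      ((isClosed_iInter fun v => ?_).inter ?_)
    · exact isClosed_eq (continuous_apply v) continuous_const
    · exact isClosed_le continuous_const (continuous_apply v)
    · exact isClosed_eq (continuous_finsetSum _ fun v _ => continuous_apply v) continuous_const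
  · intro w hw v _
    refine ⟨hw.nonneg v, ?_⟩
    by_cases hv : v ∈ s
    · rw [← hw.sum_eq]
      exact Finset.single_le_sum (fun u _ => hw.nonneg u) hv
    · rw [hw.eq_zero v hv]
      exact zero_le_one

theorem IsWeight.eq_of_affineIndependent {s : Finset E}
    (hs : AffineIndependent ℝ ((↑) : s → E)) {w w' : E → ℝ} (hw : IsWeight s w)
    (hw' : IsWeight s w') (h : ∑ v ∈ s, w v • v = ∑ v ∈ s, w' v • v) : w = w' := by
  funext v
  by_cases hv : v ∈ s
  · refine sub_eq_zero.1 (hs.eq_zero_of_sum_eq_zero_subtype (w := fun v => w v - w' v) ?_ ?_ v hv)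
    · rw [Finset.sum_sub_distrib, hw.sum_eq, hw'.sum_eq, sub_self]
    · simp_rw [sub_smul]
      rw [Finset.sum_sub_distrib, h, sub_self]
  · rw [hw.eq_zero v hv, hw'.eq_zero v hv]

namespace Geometry.SimplicialComplex

variable {T : SimplicialComplex ℝ E}

/-- A point of two simplices lies in the hull of their common vertices; its coordinates there agree
with both given ones by affine independence. -/
theorem weight_eq {s t : Finset E} (hs : s ∈ T.faces) (ht : t ∈ T.faces) {w w' : E → ℝ}
    (hw : IsWeight s w) (hw' : IsWeight t w') (h : ∑ v ∈ s, w v • v = ∑ v ∈ t, w' v • v) :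
    w = w' := by
  classical
  have h1 : ∑ v ∈ s, w v • v ∈ convexHull ℝ ((s ∩ t : Finset E) : Set E) := by
    rw [Finset.coe_inter]
    exact T.inter_subset_convexHull hs ht ⟨mem_convexHull_iff_isWeight.2 ⟨w, hw, rfl⟩,
      h ▸ mem_convexHull_iff_isWeight.2 ⟨w', hw', rfl⟩⟩
  obtain ⟨u, hu, hux⟩ := mem_convexHull_iff_isWeight.1 h1
  have h2 : u = w := (hu.mono Finset.inter_subset_left).eq_of_affineIndependent (T.indep hs) hw
    ((hu.sum_eq_of_subset Finset.inter_subset_left fun v => v).trans hux)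
  have h3 : u = w' := (hu.mono Finset.inter_subset_right).eq_of_affineIndependent (T.indep ht) hw'
    ((hu.sum_eq_of_subset Finset.inter_subset_right fun v => v).trans (hux.trans h))
  exact h2.symm.trans h3

variable (T) in
/-- The geometric realization of the complex by barycentric coordinates. -/
def realization : Set (E → ℝ) := {w | ∃ s ∈ T.faces, IsWeight s w}

theorem isCompact_realization (hT : T.faces.Finite) : IsCompact T.realization := by
  have : T.realization = ⋃ s ∈ T.faces, {w | IsWeight s w} := by
    ext w; simp [realization]
  rw [this]
  exact hT.isCompact_biUnion fun s _ => isCompact_setOf_isWeight s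

/-- A continuous bijection from a compact space to a Hausdorff one; the inverse shows that
barycentric coordinates are continuous on the whole space. -/
theorem exists_homeomorph_realization {V : Finset E} (hV : ∀ s ∈ T.faces, s ⊆ V)
    (hT : T.faces.Finite) :
    ∃ Φ : T.realization ≃ₜ T.space, ∀ w, (Φ w : E) = ∑ v ∈ V, w.1 v • v := by
  have := isCompact_iff_compactSpace.1 (isCompact_realization hT)
  let f : T.realization → T.space := fun w => ⟨∑ v ∈ V, w.1 v • v, by
    obtain ⟨s, hs, hw⟩ := w.2
    refine mem_space_iff.2 ⟨s, hs, mem_convexHull_iff_isWeight.2 ⟨w, hw, ?_⟩⟩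
    exact (hw.sum_eq_of_subset (hV s hs) fun v => v).symm⟩
  have hf : Function.Bijective f := by
    constructor
    · rintro ⟨w, s, hs, hw⟩ ⟨w', t, ht, hw'⟩ h
      refine Subtype.ext (weight_eq hs ht hw hw' ?_)
      rw [← hw.sum_eq_of_subset (hV s hs), ← hw'.sum_eq_of_subset (hV t ht)]
      exact congrArg Subtype.val h
    · rintro ⟨x, hx⟩
      obtain ⟨s, hs, hxs⟩ := mem_space_iff.1 hx
      obtain ⟨w, hw, rfl⟩ := mem_convexHull_iff_isWeight.1 hxs
      exact ⟨⟨w, s, hs, hw⟩, Subtype.ext (hw.sum_eq_of_subset (hV s hs) fun v => v)⟩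
  have hc : Continuous f := by
    refine Continuous.subtype_mk (continuous_finsetSum _ fun v _ => ?_) _
    exact ((continuous_apply v).comp continuous_subtype_val).smul continuous_const
  exact ⟨Continuous.homeoOfEquivCompactToT2 (f := Equiv.ofBijective f hf) hc, fun w => rfl⟩

/-! ### Homogeneity of open simplices -/

/-- The largest multiple of the point with coordinates `x` contained in the point `z`. -/
noncomputable def share {s : Finset E} (hs : s.Nonempty) (x z : E → ℝ) : ℝ :=
  s.inf' hs fun v => z v / x v

theorem continuous_share {s : Finset E} (hs : s.Nonempty) (x : E → ℝ) :
    Continuous (share hs x) :=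
  Continuous.finset_inf'_apply hs fun v _ => (continuous_apply v).div_const _

/-- The map of the realization which moves the point `x` of an open simplex to the point `y` of the
same open simplex. -/
noncomputable def moveFun {s : Finset E} (hs : s.Nonempty) (x y z : E → ℝ) : E → ℝ :=
  z + share hs x z • (y - x)

variable {s : Finset E} (hs : s.Nonempty) {x y z : E → ℝ}

theorem share_mul_le (hx0 : ∀ v ∈ s, 0 < x v) {v : E} (hv : v ∈ s) : share hs x z * x v ≤ z v :=
  (le_div_iff₀ (hx0 v hv)).1 (Finset.inf'_le (fun v => z v / x v) hv)

theorem share_self (hx0 : ∀ v ∈ s, 0 < x v) : share hs x x = 1 := by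
  obtain ⟨v, hv, h⟩ := s.exists_mem_eq_inf' hs fun v => x v / x v
  rw [share, h, div_self (hx0 v hv).ne']

/-- The move replaces the part `share • x` of z by `share • y`. The share being preserved, swapping
x and y inverts the move. -/
theorem share_moveFun (hx0 : ∀ v ∈ s, 0 < x v) (hy0 : ∀ v ∈ s, 0 < y v) :
    share hs y (moveFun hs x y z) = share hs x z := by
  refine le_antisymm ?_ ?_
  · obtain ⟨v, hv, h⟩ := s.exists_mem_eq_inf' hs fun v => z v / x v
    refine (Finset.inf'_le _ hv).trans ?_
    have h1 : share hs x z * x v = z v := by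
      rw [share, h, div_mul_cancel₀ _ (hx0 v hv).ne']
    rw [div_le_iff₀ (hy0 v hv)]
    simp only [moveFun, Pi.add_apply, Pi.smul_apply, Pi.sub_apply, smul_eq_mul]
    linarith
  · refine Finset.le_inf' hs _ fun v hv => ?_
    rw [le_div_iff₀ (hy0 v hv)]
    simp only [moveFun, Pi.add_apply, Pi.smul_apply, Pi.sub_apply, smul_eq_mul]
    linarith [share_mul_le hs (z := z) hx0 hv]

theorem moveFun_moveFun (hx0 : ∀ v ∈ s, 0 < x v) (hy0 : ∀ v ∈ s, 0 < y v) :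
    moveFun hs y x (moveFun hs x y z) = z := by
  rw [moveFun, share_moveFun hs hx0 hy0, moveFun]
  module

theorem moveFun_mem_realization (hx : IsWeight s x) (hy : IsWeight s y) (hx0 : ∀ v ∈ s, 0 < x v)
    (hz : z ∈ T.realization) : moveFun hs x y z ∈ T.realization := by
  obtain ⟨t, ht, hzt⟩ := hz
  refine ⟨t, ht, ?_⟩
  have hm : 0 ≤ share hs x z :=
    Finset.le_inf' hs _ fun v _ => div_nonneg (hzt.nonneg v) (hx.nonneg v)
  rcases hm.eq_or_lt with h | h
  · rwa [moveFun, ← h, zero_smul, add_zero]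
  · have hst : s ⊆ t := fun v hv => by
      by_contra hvt
      have h1 := share_mul_le hs (z := z) hx0 hv
      rw [hzt.eq_zero v hvt] at h1
      exact absurd (mul_pos h (hx0 v hv)) (not_lt.2 h1)
    refine ⟨fun v hv => ?_, fun v => ?_, ?_⟩
    · have hvs : v ∉ s := fun h => hv (hst h)
      simp [moveFun, hzt.eq_zero v hv, hx.eq_zero v hvs, hy.eq_zero v hvs]
    · simp only [moveFun, Pi.add_apply, Pi.smul_apply, Pi.sub_apply, smul_eq_mul]
      by_cases hvs : v ∈ s
      · have h1 := share_mul_le hs (z := z) hx0 hvs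
        have h2 := mul_nonneg hm (hy.nonneg v)
        linarith
      · simp [hx.eq_zero v hvs, hy.eq_zero v hvs, hzt.nonneg v]
    · simp only [moveFun, Pi.add_apply, Pi.smul_apply, Pi.sub_apply, smul_eq_mul]
      rw [Finset.sum_add_distrib, ← Finset.mul_sum, Finset.sum_sub_distrib, hzt.sum_eq,
        (hx.mono hst).sum_eq, (hy.mono hst).sum_eq]
      simp

theorem exists_homeomorph_realization_apply_eq (hs : s ∈ T.faces) (hx : IsWeight s x)
    (hy : IsWeight s y) (hx0 : ∀ v ∈ s, 0 < x v) (hy0 : ∀ v ∈ s, 0 < y v) :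
    ∃ h : T.realization ≃ₜ T.realization, h ⟨x, s, hs, hx⟩ = ⟨y, s, hs, hy⟩ := by
  have hne := nonempty_of_mem_faces hs
  have hc : ∀ x y : E → ℝ, Continuous (moveFun hne x y) := fun x y =>
    continuous_id.add ((continuous_share hne x).smul continuous_const)
  refine ⟨⟨⟨fun z => ⟨moveFun hne x y z, moveFun_mem_realization hne hx hy hx0 z.2⟩,
    fun z => ⟨moveFun hne y x z, moveFun_mem_realization hne hy hx hy0 z.2⟩,
    fun z => Subtype.ext (moveFun_moveFun hne hx0 hy0),
    fun z => Subtype.ext (moveFun_moveFun hne hy0 hx0)⟩,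
    ((hc x y).comp continuous_subtype_val).subtype_mk _,
    ((hc y x).comp continuous_subtype_val).subtype_mk _⟩, Subtype.ext ?_⟩
  change moveFun hne x y x = y
  rw [moveFun, share_self hne hx0, one_smul, add_sub_cancel]

end Geometry.SimplicialComplex

end Realization

/-! ### The boundary as a union of simplices, and its antipodal map -/

section Boundary

set_option linter.unusedSectionVars false

open Set Metric

variable {n : ℕ} {E : Type*} [NormedAddCommGroup E] [NormedSpace ℝ E]
  {T : Geometry.SimplicialComplex ℝ E} (e : EuclideanBall n ≃ₜ T.space)

theorem isClosed_ballBoundary : IsClosed (ballBoundary e) := by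
  have h : ballBoundary e = (fun u : EuclideanBall n => (e u : E)) '' {u | ‖u.1‖ = 1} := rfl
  rw [h]
  refine (IsClosed.isCompact ?_).image (continuous_subtype_val.comp e.continuous) |>.isClosed
  exact isClosed_eq continuous_subtype_val.norm continuous_const

variable {e}

/-- The boundary is a union of simplices: every boundary point lies in the relative interior of a
simplex contained in the boundary. -/
theorem exists_mem_facesIn_of_norm_eq_one {V : Finset E} (hV : ∀ s ∈ T.faces, s ⊆ V)
    {Φ : T.realization ≃ₜ T.space} (hΦ : ∀ w, (Φ w : E) = ∑ v ∈ V, w.1 v • v)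
    {u : EuclideanBall n} (hu : ‖u.1‖ = 1) :
    ∃ s ∈ facesIn T (ballBoundary e), IsWeight s (Φ.symm (e u)).1 := by
  classical
  obtain ⟨⟨z, t, ht, hzt⟩, hz⟩ : ∃ z, Φ.symm (e u) = z := ⟨_, rfl⟩
  have hzu : Φ ⟨z, t, ht, hzt⟩ = e u := by rw [← hz, Φ.apply_symm_apply]
  set s := t.filter fun v => 0 < z v with hs
  have hpos : ∀ v ∈ s, 0 < z v := fun v hv => (Finset.mem_filter.1 hv).2
  have hzero : ∀ v, v ∉ s → z v = 0 := fun v hv => by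
    by_cases hvt : v ∈ t
    · have : ¬ 0 < z v := fun h => hv (Finset.mem_filter.2 ⟨hvt, h⟩)
      exact le_antisymm (not_lt.1 this) (hzt.nonneg v)
    · exact hzt.eq_zero v hvt
  have hzs : IsWeight s z := ⟨hzero, hzt.nonneg, by
    rw [← hzt.sum_eq]
    exact Finset.sum_subset (Finset.filter_subset _ _) fun v _ hv => hzero v hv⟩
  have hne : s.Nonempty := by
    rw [Finset.nonempty_iff_ne_empty]
    intro h
    have := hzs.sum_eq
    rw [h] at this
    simp at this
  have hsT : s ∈ T.faces := T.down_closed ht (Finset.filter_subset _ _) hne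
  rw [hz]
  refine ⟨s, ⟨hsT, fun p hp => ?_⟩, hzs⟩
  obtain ⟨y, hy, rfl⟩ := mem_convexHull_iff_isWeight.1 hp
  -- A homeomorphism moving w to z induces one of the ball taking the point of w to u, so invariance
  -- of the boundary applies.
  have hopen : ∀ w, IsWeight s w → (∀ v ∈ s, 0 < w v) →
      ∑ v ∈ s, w v • v ∈ ballBoundary e := by
    intro w hw hw0
    obtain ⟨h, hh⟩ := Geometry.SimplicialComplex.exists_homeomorph_realization_apply_eq hsT hw hzs
      hw0 hpos
    let W : T.realization := ⟨w, s, hsT, hw⟩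
    let ψ : EuclideanBall n ≃ₜ EuclideanBall n :=
      (((e.trans Φ.symm).trans h).trans Φ).trans e.symm
    have hψ : ψ (e.symm (Φ W)) = u := by
      change e.symm (Φ (h (Φ.symm (e (e.symm (Φ W)))))) = u
      rw [e.apply_symm_apply, Φ.symm_apply_apply, hh, e.symm_apply_eq]
      exact hzu
    refine ⟨e.symm (Φ W), norm_eq_one_of_homeomorph ψ (by rw [hψ, hu]), ?_⟩
    rw [e.apply_symm_apply, hΦ]
    exact hw.sum_eq_of_subset (hV s hsT) fun v => v
  -- The segment from y to z lies in the open simplex except perhaps at a = 0, which closedness of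
  -- the boundary covers.
  let f : ℝ → E := fun a => ∑ v ∈ s, ((1 - a) * y v + a * z v) • v
  have hf : Continuous f := by fun_prop
  have hIoc : Ioc (0 : ℝ) 1 ⊆ f ⁻¹' ballBoundary e := by
    rintro a ⟨ha0, ha1⟩
    refine hopen (fun v => (1 - a) * y v + a * z v) ⟨fun v hv => ?_, fun v => ?_, ?_⟩ fun v hv => ?_
    · rw [hy.eq_zero v hv, hzs.eq_zero v hv]; ring
    · exact add_nonneg (mul_nonneg (by linarith) (hy.nonneg v)) (mul_nonneg ha0.le (hzs.nonneg v))
    · rw [Finset.sum_add_distrib, ← Finset.mul_sum, ← Finset.mul_sum, hy.sum_eq, hzs.sum_eq]; ring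
    · exact add_pos_of_nonneg_of_pos (mul_nonneg (by linarith) (hy.nonneg v))
        (mul_pos ha0 (hpos v hv))
  have h0 : (0 : ℝ) ∈ f ⁻¹' ballBoundary e := by
    refine closure_minimal hIoc ((isClosed_ballBoundary e).preimage hf) ?_
    rw [closure_Ioc zero_ne_one]
    exact ⟨le_rfl, zero_le_one⟩
  simpa [f] using h0

theorem sum_smul_ne_zero_of_not_isNeutral {s : Finset E} {lab : E → Fin n → ℝ}
    (hlab : ∀ v ∈ s, ∀ i, lab v i = 1 ∨ lab v i = -1) (hneutral : ¬ IsNeutral lab s) {w : E → ℝ}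
    (hw : IsWeight s w) : ∑ v ∈ s, w v • lab v ≠ 0 := by
  intro h0
  simp only [IsNeutral, not_forall] at hneutral
  obtain ⟨i, hi⟩ := hneutral
  obtain ⟨c, hc0, hc⟩ : ∃ c : ℝ, c ≠ 0 ∧ ∀ v ∈ s, lab v i = c := by
    by_cases h : ∃ v ∈ s, lab v i = -1
    · obtain ⟨v₁, hv₁, h₁⟩ := h
      exact ⟨-1, by norm_num, fun v hv => (hlab v hv i).resolve_left fun h₂ =>
        hi ⟨v₁, hv₁, v, hv, h₁, h₂⟩⟩
    · push Not at h
      exact ⟨1, one_ne_zero, fun v hv => (hlab v hv i).resolve_right (h v hv)⟩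
  have h1 : ∑ v ∈ s, w v * lab v i = 0 := by simpa using congrFun h0 i
  rw [Finset.sum_congr rfl fun v hv => by rw [hc v hv], ← Finset.sum_mul, hw.sum_eq, one_mul] at h1
  exact hc0 h1

/-- Boundary points have antipodes on the boundary, with antipodal barycentric coordinates. -/
theorem exists_antipode (hsymm : AntipodallySymmetricOn T (ballBoundary e)) {V : Finset E}
    (hV : ∀ s ∈ T.faces, s ⊆ V) {Φ : T.realization ≃ₜ T.space}
    (hΦ : ∀ w, (Φ w : E) = ∑ v ∈ V, w.1 v • v) {lab : E → Fin n → ℝ}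
    (hanti : ∀ v ∈ T.vertices, v ∈ ballBoundary e → lab v = -lab (-v))
    {u : EuclideanBall n} (hu : ‖u.1‖ = 1) :
    ∃ u' : EuclideanBall n, ‖u'.1‖ = 1 ∧ (e u' : E) = -(e u : E) ∧
      ∑ v ∈ V, (Φ.symm (e u')).1 v • lab v = -∑ v ∈ V, (Φ.symm (e u)).1 v • lab v := by
  obtain ⟨s, hs, hz⟩ := exists_mem_facesIn_of_norm_eq_one hV hΦ hu
  have hs' := hsymm s hs
  set s' := s.map (Equiv.neg E).toEmbedding with hs'def
  set z := (Φ.symm (e u)).1 with hzdef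
  have hz' : IsWeight s' fun v => z (-v) := by
    refine ⟨fun v hv => hz.eq_zero _ fun h => hv ?_, fun v => hz.nonneg _, ?_⟩
    · exact Finset.mem_map.2 ⟨-v, h, neg_neg v⟩
    · rw [hs'def, Finset.sum_map, ← hz.sum_eq]
      simp
  let Z' : T.realization := ⟨fun v => z (-v), s', hs'.1, hz'⟩
  have hpt : (Φ Z' : E) = -(e u : E) := by
    have h1 : (e u : E) = ∑ v ∈ s, z v • v := by
      rw [← hz.sum_eq_of_subset (hV s hs.1) fun v => v, hzdef, ← hΦ, Φ.apply_symm_apply]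
    rw [hΦ, hz'.sum_eq_of_subset (hV s' hs'.1) fun v => v, hs'def, Finset.sum_map, h1]
    simp
  have hmem : (Φ Z' : E) ∈ ballBoundary e := by
    refine hs'.2 (mem_convexHull_iff_isWeight.2 ⟨_, hz', ?_⟩)
    rw [hΦ]
    exact (hz'.sum_eq_of_subset (hV s' hs'.1) fun v => v).symm
  obtain ⟨u', hu', he⟩ := hmem
  refine ⟨u', hu', he.trans hpt, ?_⟩
  rw [show e u' = Φ Z' from Subtype.ext he, Φ.symm_apply_apply,
    hz'.sum_eq_of_subset (hV s' hs'.1), hz.sum_eq_of_subset (hV s hs.1), hs'def, Finset.sum_map,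
    ← Finset.sum_neg_distrib]
  refine Finset.sum_congr rfl fun v hv => ?_
  have hvT : v ∈ T.vertices := Geometry.SimplicialComplex.mem_vertices.2
    (T.down_closed hs.1 (Finset.singleton_subset_iff.2 hv) (Finset.singleton_nonempty v))
  rw [hanti v hvT (hs.2 (subset_convexHull ℝ _ hv))]
  simp

end Boundary

/-! ### The neutral simplex -/

theorem mainTheorem1 (n N : ℕ)
    (T : Geometry.SimplicialComplex ℝ (EuclideanSpace ℝ (Fin N)))
    (hfin : T.faces.Finite)
    (e : Metric.closedBall (0 : EuclideanSpace ℝ (Fin n)) 1 ≃ₜ T.space)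
    (hsymm : AntipodallySymmetricOn T (ballBoundary e))
    (lab : EuclideanSpace ℝ (Fin N) → Fin n → ℝ)
    (hlab : ∀ v ∈ T.vertices, lab v ∈ (cube n).extremePoints ℝ)
    (hanti : ∀ v ∈ T.vertices, v ∈ ballBoundary e → lab v = -lab (-v)) :
    ∃ s ∈ T.faces, IsNeutral lab s := by
  classical
  by_contra! hcon
  let V : Finset (EuclideanSpace ℝ (Fin N)) := hfin.toFinset.biUnion id
  have hV : ∀ s ∈ T.faces, s ⊆ V := fun s hs =>
    Finset.subset_biUnion_of_mem id (hfin.mem_toFinset.2 hs)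
  obtain ⟨Φ, hΦ⟩ := Geometry.SimplicialComplex.exists_homeomorph_realization hV hfin
  choose! τ hτ₁ hτe hτL using fun u hu =>
    exists_antipode (e := e) hsymm hV hΦ hanti (u := u) hu
  -- On the sphere e ∘ τ is -e, and e is a homeomorphism; off the sphere τ is arbitrary.
  have hτ : ContinuousOn τ {u : EuclideanBall n | ‖u.1‖ = 1} := by
    have h1 : ContinuousOn (fun u => e (τ u)) {u : EuclideanBall n | ‖u.1‖ = 1} := by
      refine Topology.IsInducing.subtypeVal.continuousOn_iff.2 ?_
      exact (continuous_subtype_val.comp e.continuous).neg.continuousOn.congr fun u hu => hτe u hu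
    exact (e.symm.continuous.comp_continuousOn h1).congr fun u _ => (e.symm_apply_apply _).symm
  obtain ⟨u, hu⟩ := exists_zero_of_involution hτ hτ₁
    (fun u hu => e.injective (Subtype.ext (by
      rw [hτe _ (hτ₁ u hu), hτe u hu, neg_neg])))
    (L := fun u => ∑ v ∈ V, (Φ.symm (e u)).1 v • lab v)
    (continuous_finsetSum _ fun v _ => ((continuous_apply v).comp (continuous_subtype_val.comp
      (Φ.symm.continuous.comp e.continuous))).smul continuous_const) hτL
  obtain ⟨s, hs, hz⟩ := (Φ.symm (e u)).2
  refine sum_smul_ne_zero_of_not_isNeutral (fun v hv => ?_) (hcon s hs) hz ?_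
  · exact (mem_extremePoints_cube_iff n _).1 (hlab v (Geometry.SimplicialComplex.mem_vertices.2
      (T.down_closed hs (Finset.singleton_subset_iff.2 hv) (Finset.singleton_nonempty v))))
  · rw [← hz.sum_eq_of_subset (hV s hs)]
    exact hu
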